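/- Let $d\in\mathbb N$ and $L\ge 0$. Then there are constants $c=c(L,d)\in(0,1)$ and $K=K(L,d)\ge 0$, depending only on $L$ and $d$, such that the following holds. Let $a\in C^2(\mathbb R^d)$ with $\|a\|_{C^2}:=\max_{|k|\le 2}\|D^k a\|_\infty=L$, and let $p^*$ be the probability density on $\mathbb R^d$ with $p^*(x)\propto\exp(-|x|^2/2-a(x))$. Let $\sigma_{\min}>0$ and let $\sigma:[0,1]\to(0,\infty)$, $t\mapsto\sigma_t$, be smooth and monotone with $\sigma_0=1$, $\sigma_1=\sigma_{\min}$, and assume $\sigma_{\min}<c$. For $t\in[0,1]$ and $y\in\mathbb R^d$ let $p_t(\cdot\,|\,y)$ be the density of $\mathcal N(ty,\sigma_t^2I_d)$, and for $x\in\mathbb R^d$ let $Y^{x,t}$ be a random vector with density $q\propto p_t(x\,|\,\cdot)\,p^*(\cdot)$. (a) If $c\le\sigma_{1/2}$, there is a $t^*\in[\frac12,1)$ with $\sigma_{t^*}=c$. (b) For every $t^*\in[\frac12,1)$ with $\sigma_{t^*}=c$, and more generally for every $t^*\in[\frac12,1)$ with $\sigma_{t^*}\le c$ (for instance $t^*=\frac12$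 if $\sigma_{1/2}<c$), the following posterior-covariance assumption (with $\gamma=1$, $\kappa=1$, $C=e^{2L}$) holds: for all $x\in\mathbb R^d$ and $t\in[0,1]$ the random vector $Y^{x,t}$ is well defined with finite second moments, and - (I) $|\operatorname{Cov}(Y^{x,t})_{ij}|\le K\left(\frac{\sigma_t}{t}\right)^3$ for all $i\ne j$ and $t^*<t\le 1$; - (II) $\left|\operatorname{Var}(Y^{x,t}_i)-\left(\frac{\sigma_t}{t}\right)^2\right|\le K\left(\frac{\sigma_t}{t}\right)^2\frac{\sigma_t}{t}$ for all $i$ and $t^*<t\le 1$; - (III) $|\operatorname{Cov}(Y^{x,t})_{ij}|\le e^{2L}$ for all $i,j$ and $0\le t\le t^*$. -/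

import Mathlib

open MeasureTheory ProbabilityTheory Set
open scoped ENNReal NNReal ContDiff

noncomputable section

/-- The norm `max_{|k| ≤ β} ‖D^k f‖_∞` of a `β`-times continuously differentiable function on
`ℝ^d`, with values in `[0, ∞]`. The partial derivative of order `m` in the coordinate directions
`v 0, …, v (m - 1)` is the `m`-th Fréchet derivative evaluated at the standard basis vectors
`e_{v 0}, …, e_{v (m - 1)}`; every multi-index `k` with `|k| = m` is of this form. -/
def ckNorm {d : ℕ} (β : ℕ) (f : EuclideanSpace ℝ (Fin d) → ℝ) : ℝ≥0∞ :=
  ⨆ (m : ℕ) (_ : m ≤ β) (v : Fin m → Fin d) (x : EuclideanSpace ℝ (Fin d)),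
    ‖iteratedFDeriv ℝ m f x (fun l => EuclideanSpace.single (v l) (1 : ℝ))‖ₑ

/-- The probability density proportional to `f` (for nonnegative `f` with `0 < ∫ f < ∞`). -/
def normalizedDensity {d : ℕ} (f : EuclideanSpace ℝ (Fin d) → ℝ) :
    EuclideanSpace ℝ (Fin d) → ℝ :=
  fun y => f y / ∫ z, f z

/-- The density `p⋆(x) ∝ exp(-|x|²/2 - a(x))`. -/
def targetDensity {d : ℕ} (a : EuclideanSpace ℝ (Fin d) → ℝ) :
    EuclideanSpace ℝ (Fin d) → ℝ :=
  normalizedDensity fun x => Real.exp (-(‖x‖ ^ 2 / 2) - a x)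

/-- The variance functions: smooth, monotone `σ : [0,1] → (0,∞)` with `σ_0 = 1`, `σ_1 = σ_min`. -/
structure IsVarianceFunction (σ : ℝ → ℝ) (σmin : ℝ) : Prop where
  smooth : ContDiffOn ℝ ∞ σ (Icc 0 1)
  monotone : MonotoneOn σ (Icc 0 1) ∨ AntitoneOn σ (Icc 0 1)
  pos : ∀ t ∈ Icc (0 : ℝ) 1, 0 < σ t
  zero : σ 0 = 1
  one : σ 1 = σmin

/-- The conditional density `p_t(· | y) ∝ exp(-|· - t^γ y|² / (2 σ_t²))`. -/
def condDensity {d : ℕ} (σ : ℝ → ℝ) (γ t : ℝ) (y : EuclideanSpace ℝ (Fin d)) :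
    EuclideanSpace ℝ (Fin d) → ℝ :=
  normalizedDensity fun x => Real.exp (-(‖x - t ^ γ • y‖ ^ 2 / (2 * σ t ^ 2)))

/-- The density `q ∝ p_t(x | ·) p⋆(·)` of `Y^{x,t}`. -/
def posteriorDensity {d : ℕ} (pstar : EuclideanSpace ℝ (Fin d) → ℝ) (σ : ℝ → ℝ) (γ : ℝ)
    (x : EuclideanSpace ℝ (Fin d)) (t : ℝ) : EuclideanSpace ℝ (Fin d) → ℝ :=
  normalizedDensity fun y => condDensity σ γ t y x * pstar y

/-- The law of `Y^{x,t}`. -/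
def posterior {d : ℕ} (pstar : EuclideanSpace ℝ (Fin d) → ℝ) (σ : ℝ → ℝ) (γ : ℝ)
    (x : EuclideanSpace ℝ (Fin d)) (t : ℝ) : Measure (EuclideanSpace ℝ (Fin d)) :=
  volume.withDensity fun y => ENNReal.ofReal (posteriorDensity pstar σ γ x t y)

/-- The posterior covariance assumption with parameters `γ`, `κ`, threshold `tstar`, uniform
covariance bound `C`, and `K` as the constant hidden in the symbols `≲` and `O`. The first two
fields say that `Y^{x,t}` is well defined and has finite second moments. -/
structure CovarianceAssumption {d : ℕ} (pstar : EuclideanSpace ℝ (Fin d) → ℝ) (σ : ℝ → ℝ)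
    (γ κ tstar C K : ℝ) : Prop where
  threshold_mem : tstar ∈ Ico (1 / 2 ^ (1 / γ)) 1
  isProbabilityMeasure : ∀ x, ∀ t ∈ Icc (0 : ℝ) 1,
    IsProbabilityMeasure (posterior pstar σ γ x t)
  memLp_two : ∀ x, ∀ t ∈ Icc (0 : ℝ) 1, MemLp id 2 (posterior pstar σ γ x t)
  offDiagonal : ∀ x, ∀ t ∈ Ioc tstar 1, ∀ i j, i ≠ j →
    |cov[fun y => y i, fun y => y j; posterior pstar σ γ x t]| ≤ K * (σ t / t ^ γ) ^ 3
  diagonal : ∀ x, ∀ t ∈ Ioc tstar 1, ∀ i,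
    |Var[fun y => y i; posterior pstar σ γ x t] - (σ t / t ^ γ) ^ 2| ≤
      (σ t / t ^ γ) ^ 2 * (K * (σ t / t ^ γ) ^ (1 / κ))
  uniform : ∀ x, ∀ t ∈ Icc 0 tstar, ∀ i j,
    |cov[fun y => y i, fun y => y j; posterior pstar σ γ x t]| ≤ C

end

/-! ### Exponential tilts under affine changes of variables. -/

namespace MeasureTheory

/-! Completing the square in `y` (`sq_norm_sub_smul_div_add`) shows that the posterior is the law of
`m + s • Z`, where `m = t x / (σ_t² + t²)`, `s² = σ_t² / (σ_t² + t²)`, and `Z` is a standard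
Gaussian tilted by `g z = -a (m + s • z)` (`posterior_eq_map_tilted_stdGaussian`). Its covariance is
therefore `s²` times that of `Z`, and everything reduces to perturbing a Gaussian.

Two features of `g` are used. Since `|g| ≤ L`, the tilt has density at most `e^{2L}`, so the
variances of `Z` are at most `e^{2L}`; with `s ≤ 1` this gives (III). Since `a` is `dL`-Lipschitz,
`g` is `dLs`-Lipschitz, so the tilt moves first and second moments by `O(s)` and the covariance of
`Z` is `I + O(s)`, uniformly in `x`. Multiplying by `s²`, with `s ≤ r = σ_t / t` and `|s² - r²| ≤
r³`, gives (I) and (II) at once. -/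

theorem map_tilted_comp_equiv {α β : Type*} [MeasurableSpace α] [MeasurableSpace β]
    (μ : Measure α) (e : α ≃ᵐ β) (f : β → ℝ) :
    (μ.tilted (f ∘ e)).map e = (μ.map e).tilted f := by
  ext s hs
  rw [e.map_apply, tilted_apply' _ _ (e.measurable hs), tilted_apply' _ _ hs,
    e.measurableEmbedding.restrict_map, lintegral_map_equiv, integral_map_equiv]
  rfl

theorem smul_measure_tilted {α : Type*} [MeasurableSpace α] (μ : Measure α) {c : ℝ≥0∞}
    (hc : c ≠ 0) (hc' : c ≠ ⊤) (f : α → ℝ) : (c • μ).tilted f = μ.tilted f := by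
  have hpos : 0 < c.toReal := ENNReal.toReal_pos hc hc'
  ext s hs
  rw [tilted_apply' _ _ hs, tilted_apply' _ _ hs, Measure.restrict_smul, lintegral_smul_measure,
    smul_eq_mul, ← lintegral_const_mul' _ _ hc', integral_smul_measure]
  congr 1 with x
  conv_lhs => rw [← ENNReal.ofReal_toReal hc', ← ENNReal.ofReal_mul hpos.le]
  rw [smul_eq_mul, mul_div_assoc', ENNReal.toReal_ofReal hpos.le, mul_div_mul_left _ _ hpos.ne']

theorem withDensity_normalized_eq_tilted {α : Type*} [MeasurableSpace α] (μ : Measure α)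
    {p F : α → ℝ} {k : ℝ} (hk : 0 < k) (h : ∀ y, p y = k * Real.exp (F y)) :
    μ.withDensity (fun y => ENNReal.ofReal (p y / ∫ z, p z ∂μ)) = μ.tilted F := by
  rw [Measure.tilted]
  congr 1 with y
  simp_rw [h]
  rw [integral_const_mul, mul_div_mul_left _ _ hk.ne']

/-- The Jacobian is a constant factor, and a tilt is normalized, so it cancels. -/
theorem volume_tilted_affine {E : Type*} [NormedAddCommGroup E] [NormedSpace ℝ E]
    [MeasurableSpace E] [BorelSpace E] [FiniteDimensional ℝ E] (μ : Measure E) [μ.IsAddHaarMeasure]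
    (m : E) {s : ℝ} (hs : s ≠ 0) (F : E → ℝ) :
    μ.tilted F = (μ.tilted fun z => F (m + s • z)).map (fun z => m + s • z) := by
  let e : E ≃ᵐ E := ((Homeomorph.smulOfNeZero s hs).trans (Homeomorph.addLeft m)).toMeasurableEquiv
  have he : ∀ z, e z = m + s • z := fun z => rfl
  have hmap : μ.map e = ENNReal.ofReal |(s ^ Module.finrank ℝ E)⁻¹| • μ := by
    have : (e : E → E) = (fun z => m + z) ∘ (fun z => s • z) := rfl
    rw [this, ← Measure.map_map (by fun_prop) (by fun_prop), Measure.map_addHaar_smul μ hs,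
      Measure.map_smul, map_add_left_eq_self]
  have := map_tilted_comp_equiv μ e F
  rw [hmap, smul_measure_tilted _ _ ENNReal.ofReal_ne_top] at this
  · exact this.symm
  · simp [hs]

end MeasureTheory

/-! ### The standard Gaussian as a tilt of Lebesgue measure. -/

namespace ProbabilityTheory

theorem integrable_exp_neg_norm_sq_div_two {V : Type*} [NormedAddCommGroup V]
    [InnerProductSpace ℝ V] [FiniteDimensional ℝ V] [MeasurableSpace V] [BorelSpace V] :
    Integrable (fun z : V => Real.exp (-(‖z‖ ^ 2 / 2))) := by
  refine Integrable.congr (f := fun z : V => Real.exp (-(1 / 2) * ‖z‖ ^ 2)) ?_ (by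
    filter_upwards with z
    ring_nf)
  refine Integrable.of_integral_ne_zero ?_
  rw [GaussianFourier.integral_rexp_neg_mul_sq_norm (by norm_num)]
  positivity

/-- Both sides have the same characteristic function, by the Gaussian Fourier integral. -/
theorem volume_tilted_eq_stdGaussian {V : Type*} [NormedAddCommGroup V]
    [InnerProductSpace ℝ V] [FiniteDimensional ℝ V] [MeasurableSpace V] [BorelSpace V] :
    (volume : Measure V).tilted (fun z => -(‖z‖ ^ 2 / 2)) = stdGaussian V := by
  have hint := integrable_exp_neg_norm_sq_div_two (V := V)
  have := isProbabilityMeasure_tilted hint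
  apply Measure.ext_of_charFun
  ext t
  rw [charFun_stdGaussian, charFun_apply, integral_tilted]
  have h1 : ∫ z : V, Real.exp (-(‖z‖ ^ 2 / 2)) = (2 * Real.pi) ^ (Module.finrank ℝ V / 2 : ℝ) := by
    rw [show 2 * Real.pi = Real.pi / (1 / 2) by ring,
      ← GaussianFourier.integral_rexp_neg_mul_sq_norm (by norm_num)]
    congr 1 with z
    ring_nf
  have h2 := GaussianFourier.integral_cexp_neg_mul_sq_norm_add (V := V) (b := 1 / 2) (by norm_num)
    Complex.I t
  have h3 : ((Real.pi : ℂ) / (1 / 2)) ^ (Module.finrank ℝ V / 2 : ℂ) =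
      (((2 * Real.pi) ^ (Module.finrank ℝ V / 2 : ℝ) : ℝ) : ℂ) := by
    rw [Complex.ofReal_cpow (by positivity)]
    push_cast
    congr 1
    ring
  have hpos : 0 < (2 * Real.pi) ^ (Module.finrank ℝ V / 2 : ℝ) := by positivity
  rw [h1]
  set c := (2 * Real.pi) ^ (Module.finrank ℝ V / 2 : ℝ)
  have h4 : ∀ x : V, (Real.exp (-(‖x‖ ^ 2 / 2)) / c) • Complex.exp (inner ℝ x t * Complex.I) =
      (c : ℂ)⁻¹ * Complex.exp (-(1 / 2) * ‖x‖ ^ 2 + Complex.I * inner ℝ t x) := by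
    intro x
    rw [Complex.exp_add, Complex.real_smul, real_inner_comm]
    push_cast
    rw [mul_comm Complex.I, show -((‖x‖ : ℂ) ^ 2 / 2) = -(1 / 2) * ‖x‖ ^ 2 by ring]
    ring
  simp_rw [h4]
  rw [integral_const_mul, h2, h3, ← mul_assoc, inv_mul_cancel₀ (by exact_mod_cast hpos.ne'),
    one_mul, Complex.I_sq]
  congr 1
  ring

end ProbabilityTheory

/-! ### Tilts by a bounded function. -/

section BoundedTilt

variable {Ω : Type*} [MeasurableSpace Ω] {μ : Measure Ω} {g h f : Ω → ℝ} {L M : ℝ}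

theorem integrable_exp_mul_of_bounded (hg : Measurable g) (hL : ∀ z, |g z| ≤ L)
    (hf : Integrable f μ) : Integrable (fun z => Real.exp (g z) * f z) μ :=
  hf.bdd_mul (c := Real.exp L) (by fun_prop) (.of_forall fun z => by
    rw [Real.norm_of_nonneg (Real.exp_pos _).le]
    exact Real.exp_le_exp.2 (abs_le.1 (hL z)).2)

variable [IsProbabilityMeasure μ]

theorem integrable_exp_of_bounded (hg : Measurable g) (hL : ∀ z, |g z| ≤ L) :
    Integrable (fun z => Real.exp (g z)) μ := by
  simpa using integrable_exp_mul_of_bounded hg hL (integrable_const (μ := μ) (1 : ℝ))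

theorem integrable_tilted_of_bounded (hg : Measurable g) (hL : ∀ z, |g z| ≤ L)
    (hf : Integrable f μ) : Integrable f (μ.tilted g) :=
  (integrable_tilted_iff (integrable_exp_of_bounded hg hL) f).2
    (integrable_exp_mul_of_bounded hg hL hf)

theorem exp_neg_le_integral_exp (hg : Measurable g) (hL : ∀ z, |g z| ≤ L) :
    Real.exp (-L) ≤ ∫ z, Real.exp (g z) ∂μ := by
  have := integral_mono (μ := μ) (integrable_const (Real.exp (-L)))
    (integrable_exp_of_bounded hg hL) fun z => Real.exp_le_exp.2 (abs_le.1 (hL z)).1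
  simpa using this

/-- The density `e^g / Z` is at most `e^L / e^{-L}`. -/
theorem integral_tilted_le (hg : Measurable g) (hL : ∀ z, |g z| ≤ L)
    (hf0 : ∀ z, 0 ≤ f z) (hf : Integrable f μ) :
    ∫ z, f z ∂(μ.tilted g) ≤ Real.exp (2 * L) * ∫ z, f z ∂μ := by
  rw [integral_tilted, ← integral_const_mul]
  have hZ := exp_neg_le_integral_exp (μ := μ) hg hL
  have hZ0 := (Real.exp_pos _).trans_le hZ
  refine integral_mono ?_ (hf.const_mul _) fun z => ?_
  · refine ((integrable_exp_mul_of_bounded hg hL hf).div_const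
      (∫ z, Real.exp (g z) ∂μ)).congr (.of_forall fun z => ?_)
    simp only [smul_eq_mul]
    ring
  · refine mul_le_mul_of_nonneg_right ?_ (hf0 z)
    rw [div_le_iff₀ hZ0]
    calc Real.exp (g z) ≤ Real.exp L := Real.exp_le_exp.2 (abs_le.1 (hL z)).2
      _ = Real.exp (2 * L) * Real.exp (-L) := by rw [← Real.exp_add]; ring_nf
      _ ≤ _ := by gcongr

theorem abs_exp_sub_exp_le {a b L : ℝ} (ha : a ≤ L) (hb : b ≤ L) :
    |Real.exp a - Real.exp b| ≤ Real.exp L * |a - b| := by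
  wlog hab : b ≤ a generalizing a b
  · rw [abs_sub_comm, abs_sub_comm a]
    exact this hb ha (le_of_not_ge hab)
  rw [abs_of_nonneg (sub_nonneg.2 (Real.exp_le_exp.2 hab)), abs_of_nonneg (sub_nonneg.2 hab)]
  have h1 : Real.exp b = Real.exp a * Real.exp (b - a) := by rw [← Real.exp_add]; ring_nf
  calc Real.exp a - Real.exp b = Real.exp a * (1 - Real.exp (b - a)) := by rw [h1]; ring
    _ ≤ Real.exp a * (a - b) :=
      mul_le_mul_of_nonneg_left (by linarith [Real.add_one_le_exp (b - a)]) (Real.exp_pos _).le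
    _ ≤ _ := by
      have := sub_nonneg.2 hab
      gcongr

/-- As `μ` has mass one, the difference is the `μ`-average over `w` of `e^{g z} - e^{g w}`, to which
the mean value bound applies. -/
theorem abs_exp_sub_integral_exp_le (hg : Measurable g) (hL : ∀ z, |g z| ≤ L)
    (hM : ∀ z w, |g z - g w| ≤ M * (h z + h w)) (hh : Integrable h μ) (z : Ω) :
    |Real.exp (g z) - ∫ w, Real.exp (g w) ∂μ| ≤ Real.exp L * M * (h z + ∫ w, h w ∂μ) := by
  have hint := integrable_exp_of_bounded (μ := μ) hg hL
  have h1 : Real.exp (g z) - ∫ w, Real.exp (g w) ∂μ =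
      ∫ w, (Real.exp (g z) - Real.exp (g w)) ∂μ := by
    rw [integral_sub (integrable_const _) hint]
    simp
  have h2 : Real.exp L * M * (h z + ∫ w, h w ∂μ) =
      ∫ w, Real.exp L * M * (h z + h w) ∂μ := by
    rw [integral_const_mul, integral_add (integrable_const _) hh]
    simp
  rw [h1, h2]
  refine abs_integral_le_integral_abs.trans (integral_mono ((integrable_const _).sub hint).abs
    (((integrable_const _).add hh).const_mul _) fun w => ?_)
  refine (abs_exp_sub_exp_le (abs_le.1 (hL z)).2 (abs_le.1 (hL w)).2).trans ?_
  rw [mul_assoc]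
  exact mul_le_mul_of_nonneg_left (hM z w) (Real.exp_pos _).le

/-- A tilt by a function `g` with `|g z - g w| ≤ M (h z + h w)` changes expectations by `O(M)`. -/
theorem abs_integral_tilted_sub_le (hg : Measurable g) (hL : ∀ z, |g z| ≤ L)
    (hM : ∀ z w, |g z - g w| ≤ M * (h z + h w))
    (hh : Integrable h μ) (hf : Integrable f μ) (hfh : Integrable (fun z => |f z| * h z) μ) :
    |∫ z, f z ∂(μ.tilted g) - ∫ z, f z ∂μ| ≤
      Real.exp (2 * L) * M * (∫ z, |f z| * h z ∂μ + (∫ z, |f z| ∂μ) * ∫ z, h z ∂μ) := by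
  have hZ := exp_neg_le_integral_exp (μ := μ) hg hL
  have hZ0 := (Real.exp_pos _).trans_le hZ
  have hosc := abs_exp_sub_integral_exp_le (μ := μ) hg hL hM hh
  set Z := ∫ z, Real.exp (g z) ∂μ
  have hi : Integrable (fun z => (Real.exp (g z) / Z) • f z) μ := by
    refine ((integrable_exp_mul_of_bounded hg hL hf).div_const Z).congr (.of_forall fun z => ?_)
    simp only [smul_eq_mul]
    ring
  have h2 : Real.exp (2 * L) * M * (∫ z, |f z| * h z ∂μ + (∫ z, |f z| ∂μ) * ∫ z, h z ∂μ) =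
      ∫ z, Real.exp (2 * L) * M * (|f z| * h z + |f z| * ∫ w, h w ∂μ) ∂μ := by
    rw [integral_const_mul, integral_add hfh (hf.abs.mul_const _), integral_mul_const]
  rw [integral_tilted, ← integral_sub hi hf, h2]
  refine abs_integral_le_integral_abs.trans (integral_mono (hi.sub hf).abs
    ((hfh.add (hf.abs.mul_const _)).const_mul _) fun z => ?_)
  -- One factor `e^L` comes from normalization, the other from the slope of `exp`; together they
  -- give `e^{2L}`.
  have hZinv : Z⁻¹ ≤ Real.exp L := by
    rw [← neg_neg L, Real.exp_neg (-L)]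
    exact inv_anti₀ (Real.exp_pos _) hZ
  calc |(Real.exp (g z) / Z) • f z - f z| = Z⁻¹ * |Real.exp (g z) - Z| * |f z| := by
        rw [← abs_of_pos (inv_pos.2 hZ0), ← abs_mul, ← abs_mul, smul_eq_mul]
        congr 1
        ring_nf
        rw [mul_inv_cancel₀ hZ0.ne']
        ring
    _ ≤ Real.exp L * (Real.exp L * M * (h z + ∫ w, h w ∂μ)) * |f z| := by
        gcongr
        exact hosc z
    _ = _ := by
        rw [two_mul, Real.exp_add]
        ring

end BoundedTilt

/-- Nonnegativity of `Var[X ± Y]` gives `2 |cov| ≤ Var X + Var Y`. -/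
theorem abs_covariance_le {Ω : Type*} [MeasurableSpace Ω] {μ : Measure Ω} [IsProbabilityMeasure μ]
    {X Y : Ω → ℝ} {C : ℝ} (hX : MemLp X 2 μ) (hY : MemLp Y 2 μ) (hXC : Var[X; μ] ≤ C)
    (hYC : Var[Y; μ] ≤ C) : |cov[X, Y; μ]| ≤ C := by
  have h1 := variance_add hX hY
  have h2 := variance_sub hX hY
  have h3 := variance_nonneg (X + Y) μ
  have h4 := variance_nonneg (X - Y) μ
  rw [abs_le]
  constructor <;> linarith

/-! ### Moments and covariance of a tilted standard Gaussian. -/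

section GaussianTilt

variable {d : ℕ}

theorem integrable_norm_pow_stdGaussian (n : ℕ) :
    Integrable (fun z : EuclideanSpace ℝ (Fin d) => ‖z‖ ^ n)
      (stdGaussian (EuclideanSpace ℝ (Fin d))) :=
  (IsGaussian.memLp_id _ (n : ℝ≥0∞) (by simp)).integrable_norm_pow'

theorem integral_eval_stdGaussian (i : Fin d) :
    ∫ z, z i ∂(stdGaussian (EuclideanSpace ℝ (Fin d))) = 0 :=
  integral_strongDual_stdGaussian (EuclideanSpace.proj (𝕜 := ℝ) i)

theorem memLp_eval {μ : Measure (EuclideanSpace ℝ (Fin d))} (h : MemLp id 2 μ) (i : Fin d) :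
    MemLp (fun z : EuclideanSpace ℝ (Fin d) => z i) 2 μ :=
  h.mono (Measurable.aestronglyMeasurable (by fun_prop))
    (.of_forall fun z => PiLp.norm_apply_le z i)

theorem integral_eval_mul_eval_stdGaussian (i j : Fin d) :
    ∫ z, z i * z j ∂(stdGaussian (EuclideanSpace ℝ (Fin d))) = if i = j then 1 else 0 := by
  have h := covariance_eval_multivariateGaussian (μ := (0 : EuclideanSpace ℝ (Fin d)))
    Matrix.PosSemidef.one i j
  have hm := fun i => memLp_eval (d := d) (IsGaussian.memLp_two_id (μ := stdGaussian _)) i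
  rw [multivariateGaussian_zero_one, covariance_eq_sub (hm i) (hm j), integral_eval_stdGaussian,
    Matrix.one_apply] at h
  simpa using h

theorem abs_eval_le_norm (z : EuclideanSpace ℝ (Fin d)) (i : Fin d) : |z i| ≤ ‖z‖ :=
  PiLp.norm_apply_le z i

theorem memLp_two_of_tilted_stdGaussian {g : EuclideanSpace ℝ (Fin d) → ℝ} {L : ℝ}
    (hg : Measurable g) (hL : ∀ z, |g z| ≤ L) :
    MemLp id 2 ((stdGaussian (EuclideanSpace ℝ (Fin d))).tilted g) := by
  rw [← memLp_norm_iff (by fun_prop), memLp_two_iff_integrable_sq (by fun_prop)]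
  exact integrable_tilted_of_bounded hg hL (integrable_norm_pow_stdGaussian 2)

/-- The `n`-th absolute moment of the standard Gaussian distribution on `ℝ^d`. -/
noncomputable def gaussianMoment (d n : ℕ) : ℝ := ∫ z, ‖z‖ ^ n ∂(stdGaussian (EuclideanSpace ℝ (Fin d)))

theorem gaussianMoment_nonneg (d n : ℕ) : 0 ≤ gaussianMoment d n :=
  integral_nonneg fun _ => by positivity

theorem abs_integral_tilted_stdGaussian_sub_le {g f : EuclideanSpace ℝ (Fin d) → ℝ} {L M : ℝ}
    (hg : Measurable g) (hL : ∀ z, |g z| ≤ L) (hM0 : 0 ≤ M)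
    (hM : ∀ z w, |g z - g w| ≤ M * (‖z‖ + ‖w‖)) (hf : Measurable f) {n : ℕ}
    (hfn : ∀ z, |f z| ≤ ‖z‖ ^ n) :
    |∫ z, f z ∂((stdGaussian _).tilted g) - ∫ z, f z ∂(stdGaussian _)| ≤
      Real.exp (2 * L) * M *
        (gaussianMoment d (n + 1) + gaussianMoment d n * gaussianMoment d 1) := by
  have hfi : Integrable f (stdGaussian _) :=
    (integrable_norm_pow_stdGaussian n).mono' hf.aestronglyMeasurable (.of_forall hfn)
  have hle : ∀ z, |f z| * ‖z‖ ≤ ‖z‖ ^ (n + 1) := fun z => by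
    rw [pow_succ]
    exact mul_le_mul_of_nonneg_right (hfn z) (norm_nonneg z)
  have hfh : Integrable (fun z => |f z| * ‖z‖) (stdGaussian _) :=
    (integrable_norm_pow_stdGaussian (n + 1)).mono' (by fun_prop) (.of_forall fun z => by
      rw [Real.norm_of_nonneg (by positivity)]
      exact hle z)
  have h1 : Integrable (fun z => ‖z‖) (stdGaussian (EuclideanSpace ℝ (Fin d))) := by
    simpa using integrable_norm_pow_stdGaussian (d := d) 1
  refine (abs_integral_tilted_sub_le hg hL hM h1 hfi hfh).trans ?_
  have h2 : ∫ z, ‖z‖ ∂(stdGaussian (EuclideanSpace ℝ (Fin d))) = gaussianMoment d 1 := by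
    simp [gaussianMoment]
  rw [h2]
  refine mul_le_mul_of_nonneg_left (add_le_add
    (integral_mono hfh (integrable_norm_pow_stdGaussian _) hle)
    (mul_le_mul_of_nonneg_right ?_ (gaussianMoment_nonneg _ _))) (by positivity)
  exact integral_mono hfi.abs (integrable_norm_pow_stdGaussian _) hfn

/-- The constant in the covariance expansion of a tilted standard Gaussian. -/
noncomputable def tiltConstant (d : ℕ) (L B : ℝ) : ℝ :=
  Real.exp (2 * L) * (gaussianMoment d 3 + gaussianMoment d 2 * gaussianMoment d 1) +
    B * (Real.exp (2 * L) * (gaussianMoment d 2 + gaussianMoment d 1 * gaussianMoment d 1)) ^ 2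

theorem tiltConstant_nonneg (d : ℕ) (L : ℝ) {B : ℝ} (hB : 0 ≤ B) : 0 ≤ tiltConstant d L B := by
  have := gaussianMoment_nonneg d
  have h1 := this 1
  have h2 := this 2
  have h3 := this 3
  unfold tiltConstant
  positivity

/-- The second moments move by `O(M)`. The Gaussian means vanish, so the product of the tilted means
is `O(M²)`. -/
theorem abs_covariance_tilted_stdGaussian_sub_le {g : EuclideanSpace ℝ (Fin d) → ℝ} {L M B : ℝ}
    (hg : Measurable g) (hL : ∀ z, |g z| ≤ L) (hM0 : 0 ≤ M) (hMB : M ≤ B)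
    (hM : ∀ z w, |g z - g w| ≤ M * (‖z‖ + ‖w‖)) (i j : Fin d) :
    |cov[fun z => z i, fun z => z j; (stdGaussian (EuclideanSpace ℝ (Fin d))).tilted g] -
      if i = j then 1 else 0| ≤ M * tiltConstant d L B := by
  have : IsProbabilityMeasure ((stdGaussian (EuclideanSpace ℝ (Fin d))).tilted g) :=
    isProbabilityMeasure_tilted (integrable_exp_of_bounded hg hL)
  have hm := memLp_eval (memLp_two_of_tilted_stdGaussian hg hL)
  have h1 : ∀ i : Fin d, |∫ z, z i ∂((stdGaussian (EuclideanSpace ℝ (Fin d))).tilted g)| ≤ M *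
      (Real.exp (2 * L) * (gaussianMoment d 2 + gaussianMoment d 1 * gaussianMoment d 1)) := by
    intro i
    have := abs_integral_tilted_stdGaussian_sub_le (f := fun z : EuclideanSpace ℝ (Fin d) => z i)
      (n := 1) hg hL hM0 hM (by fun_prop) (by simpa using fun z => abs_eval_le_norm z i)
    rw [integral_eval_stdGaussian, sub_zero] at this
    exact this.trans_eq (by ring)
  have h2 := abs_integral_tilted_stdGaussian_sub_le
    (f := fun z : EuclideanSpace ℝ (Fin d) => z i * z j)
    (n := 2) hg hL hM0 hM (by fun_prop) (fun z => by
      rw [abs_mul, sq]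
      exact mul_le_mul (abs_eval_le_norm z i) (abs_eval_le_norm z j) (abs_nonneg _)
        (norm_nonneg _))
  rw [integral_eval_mul_eval_stdGaussian] at h2
  rw [covariance_eq_sub (hm i) (hm j), sub_right_comm]
  refine (abs_sub _ _).trans ?_
  have h3 := mul_le_mul (h1 i) (h1 j) (abs_nonneg _) ((abs_nonneg _).trans (h1 i))
  rw [← abs_mul] at h3
  refine (add_le_add h2 h3).trans ?_
  set b := Real.exp (2 * L) * (gaussianMoment d 2 + gaussianMoment d 1 * gaussianMoment d 1)
  -- The a priori bound `B` turns the quadratic error into one linear in `M`.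
  have h4 : M * (M * b ^ 2) ≤ M * (B * b ^ 2) := by gcongr
  calc _ = M * (Real.exp (2 * L) * (gaussianMoment d 3 + gaussianMoment d 2 * gaussianMoment d 1))
        + M * (M * b ^ 2) := by ring
    _ ≤ _ := by
      rw [tiltConstant, mul_add M (_ * (_ + _))]
      exact add_le_add le_rfl h4

theorem variance_tilted_stdGaussian_le {g : EuclideanSpace ℝ (Fin d) → ℝ} {L : ℝ}
    (hg : Measurable g) (hL : ∀ z, |g z| ≤ L) (i : Fin d) :
    Var[fun z => z i; (stdGaussian (EuclideanSpace ℝ (Fin d))).tilted g] ≤ Real.exp (2 * L) := by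
  have : IsProbabilityMeasure ((stdGaussian (EuclideanSpace ℝ (Fin d))).tilted g) :=
    isProbabilityMeasure_tilted (integrable_exp_of_bounded hg hL)
  refine (variance_le_expectation_sq (Measurable.aestronglyMeasurable (by fun_prop))).trans ?_
  have hint : Integrable (fun z : EuclideanSpace ℝ (Fin d) => z i ^ 2) (stdGaussian _) :=
    (memLp_eval IsGaussian.memLp_two_id i).integrable_sq
  refine (integral_tilted_le hg hL (fun z => sq_nonneg (z i)) hint).trans_eq ?_
  have := integral_eval_mul_eval_stdGaussian i i
  simp_rw [sq, this, if_true, mul_one]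

end GaussianTilt

/-! ### From the `C^k` norm to a sup bound and a Lipschitz bound. -/

section CkNorm

variable {d : ℕ} {L : ℝ≥0} {a : EuclideanSpace ℝ (Fin d) → ℝ}

theorem norm_iteratedFDeriv_single_le_of_ckNorm {β m : ℕ} (ha : ckNorm β a = (L : ℝ≥0∞))
    (hm : m ≤ β) (v : Fin m → Fin d) (x : EuclideanSpace ℝ (Fin d)) :
    ‖iteratedFDeriv ℝ m a x (fun l => EuclideanSpace.single (v l) (1 : ℝ))‖ ≤ L := by
  have h : ‖iteratedFDeriv ℝ m a x (fun l => EuclideanSpace.single (v l) (1 : ℝ))‖ₑ ≤ L := by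
    rw [← ha, ckNorm]
    exact le_iSup_of_le m (le_iSup_of_le hm (le_iSup_of_le v (le_iSup_of_le x le_rfl)))
  rw [enorm_le_coe] at h
  exact_mod_cast h

theorem abs_le_of_ckNorm {β : ℕ} (ha : ckNorm β a = (L : ℝ≥0∞)) (x : EuclideanSpace ℝ (Fin d)) :
    |a x| ≤ L := by
  simpa using norm_iteratedFDeriv_single_le_of_ckNorm ha (Nat.zero_le _) Fin.elim0 x

/-- The norm controls each partial derivative separately; summing over `d` coordinates costs the
factor `d`. -/
theorem norm_fderiv_le_of_ckNorm {β : ℕ} (hβ : 1 ≤ β) (ha : ckNorm β a = (L : ℝ≥0∞))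
    (x : EuclideanSpace ℝ (Fin d)) : ‖fderiv ℝ a x‖ ≤ d * L := by
  refine ContinuousLinearMap.opNorm_le_bound _ (by positivity) fun v => ?_
  have hv : v = ∑ i, v i • EuclideanSpace.single i (1 : ℝ) := by
    have := (EuclideanSpace.basisFun (Fin d) ℝ).sum_repr v
    simpa using this.symm
  have hi : ∀ i, ‖fderiv ℝ a x (EuclideanSpace.single i 1)‖ ≤ L := fun i => by
    have := norm_iteratedFDeriv_single_le_of_ckNorm ha hβ (fun _ => i) x
    rwa [iteratedFDeriv_one_apply] at this
  calc ‖fderiv ℝ a x v‖ = ‖∑ i, v i * fderiv ℝ a x (EuclideanSpace.single i 1)‖ := by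
        conv_lhs => rw [hv]
        simp
    _ ≤ ∑ i : Fin d, ‖v‖ * L := by
        refine norm_sum_le_of_le _ fun i _ => ?_
        rw [norm_mul]
        exact mul_le_mul (PiLp.norm_apply_le v i) (hi i) (norm_nonneg _) (norm_nonneg _)
    _ = d * L * ‖v‖ := by
        simp
        ring

theorem abs_sub_le_of_ckNorm {β : ℕ} (hβ : 1 ≤ β) (hd : Differentiable ℝ a)
    (ha : ckNorm β a = (L : ℝ≥0∞)) (x y : EuclideanSpace ℝ (Fin d)) :
    |a x - a y| ≤ d * L * ‖x - y‖ :=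
  convex_univ.norm_image_sub_le_of_norm_fderiv_le (fun z _ => hd z)
    (fun z _ => norm_fderiv_le_of_ckNorm hβ ha z) (mem_univ y) (mem_univ x)

end CkNorm

/-! ### The posterior as an affine image of a tilted Gaussian. -/

section Posterior

variable {d : ℕ} {L : ℝ} {a : EuclideanSpace ℝ (Fin d) → ℝ}

theorem sq_norm_sub_smul_div_add {V : Type*} [NormedAddCommGroup V] [InnerProductSpace ℝ V]
    (x y : V) {v t : ℝ} (hv : 0 < v) :
    ‖x - t • y‖ ^ 2 / (2 * v) + ‖y‖ ^ 2 / 2 =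
      ‖y - (t / (v + t ^ 2)) • x‖ ^ 2 / (2 * (v / (v + t ^ 2))) + ‖x‖ ^ 2 / (2 * (v + t ^ 2)) := by
  have h : v + t ^ 2 ≠ 0 := by positivity
  rw [norm_sub_sq_real, norm_sub_sq_real, inner_smul_right, inner_smul_right, norm_smul, norm_smul,
    real_inner_comm, mul_pow, mul_pow, Real.norm_eq_abs, Real.norm_eq_abs, sq_abs, sq_abs]
  field_simp
  ring

theorem integrable_exp_neg_norm_sq_sub_of_bounded (ha : Measurable a) (hL : ∀ x, |a x| ≤ L) :
    Integrable (fun x : EuclideanSpace ℝ (Fin d) => Real.exp (-(‖x‖ ^ 2 / 2) - a x)) := by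
  refine (integrable_exp_mul_of_bounded (g := fun x => -a x) (by fun_prop)
    (fun z => by rw [abs_neg]; exact hL z) integrable_exp_neg_norm_sq_div_two).congr
    (.of_forall fun x => ?_)
  simp only [← Real.exp_add]
  ring_nf

theorem integral_exp_neg_norm_sub_sq_div (c : EuclideanSpace ℝ (Fin d)) {v : ℝ} (hv : 0 < v) :
    ∫ x : EuclideanSpace ℝ (Fin d), Real.exp (-(‖x - c‖ ^ 2 / (2 * v))) =
      (2 * Real.pi * v) ^ ((d : ℝ) / 2) := by
  rw [integral_sub_right_eq_self (fun x => Real.exp (-(‖x‖ ^ 2 / (2 * v)))) c]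
  have h := GaussianFourier.integral_rexp_neg_mul_sq_norm (V := EuclideanSpace ℝ (Fin d))
    (b := 1 / (2 * v)) (by positivity)
  rw [finrank_euclideanSpace_fin] at h
  rw [show 2 * Real.pi * v = Real.pi / (1 / (2 * v)) by field_simp, ← h]
  congr 1 with x
  ring_nf

/-- The law of `Y^{x,t}` is the affine image of a tilted standard Gaussian. -/
theorem posterior_eq_map_tilted_stdGaussian (ha : Measurable a) (hL : ∀ x, |a x| ≤ L)
    {σ : ℝ → ℝ} {t : ℝ} (hσ : 0 < σ t) (x : EuclideanSpace ℝ (Fin d)) {s : ℝ} (hs : 0 < s)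
    (hs2 : s ^ 2 = σ t ^ 2 / (σ t ^ 2 + t ^ 2)) :
    posterior (targetDensity a) σ 1 x t =
      ((stdGaussian (EuclideanSpace ℝ (Fin d))).tilted fun z =>
        -a ((t / (σ t ^ 2 + t ^ 2)) • x + s • z)).map
          fun z => (t / (σ t ^ 2 + t ^ 2)) • x + s • z := by
  set m := (t / (σ t ^ 2 + t ^ 2)) • x
  have hI := integral_exp_pos (integrable_exp_neg_norm_sq_sub_of_bounded ha hL)
  have hJ : 0 < (2 * Real.pi * σ t ^ 2) ^ ((d : ℝ) / 2) := by positivity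
  set I := ∫ z : EuclideanSpace ℝ (Fin d), Real.exp (-(‖z‖ ^ 2 / 2) - a z) with hIdef
  -- The prefactor does not depend on `y`, because the normalization of `p_t(· | y)` does not; it
  -- therefore drops out of the posterior.
  have hdens : ∀ y, condDensity σ 1 t y x * targetDensity a y =
      (Real.exp (-(‖x‖ ^ 2 / (2 * (σ t ^ 2 + t ^ 2)))) /
        ((2 * Real.pi * σ t ^ 2) ^ ((d : ℝ) / 2) * I)) *
        Real.exp (-(‖y - m‖ ^ 2 / (2 * s ^ 2)) - a y) := by
    intro y
    simp only [condDensity, targetDensity, normalizedDensity, Real.rpow_one]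
    rw [integral_exp_neg_norm_sub_sq_div _ (by positivity), ← hIdef, div_mul_div_comm,
      ← Real.exp_add, div_mul_eq_mul_div, ← Real.exp_add]
    congr 2
    have := sq_norm_sub_smul_div_add x y (t := t) (sq_pos_of_pos hσ)
    rw [hs2]
    linarith
  have h1 : posterior (targetDensity a) σ 1 x t =
      volume.tilted fun y => -(‖y - m‖ ^ 2 / (2 * s ^ 2)) - a y :=
    withDensity_normalized_eq_tilted volume (by positivity) hdens
  rw [h1, volume_tilted_affine volume m hs.ne', ← volume_tilted_eq_stdGaussian,
    tilted_tilted integrable_exp_neg_norm_sq_div_two]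
  congr 2 with z
  simp only [Pi.add_apply, add_sub_cancel_left, norm_smul, Real.norm_of_nonneg hs.le]
  field_simp
  ring

end Posterior

/-! ### Covariance bounds for the posterior. -/

section PosteriorCovariance

variable {d : ℕ} {μ : Measure (EuclideanSpace ℝ (Fin d))}

theorem memLp_map_affine (h : MemLp id 2 μ) [IsFiniteMeasure μ] (m : EuclideanSpace ℝ (Fin d))
    (s : ℝ) : MemLp id 2 (μ.map fun z => m + s • z) := by
  rw [memLp_map_measure_iff (by fun_prop) (by fun_prop)]
  exact (memLp_const m).add (h.const_smul s)

theorem covariance_map_affine (h : MemLp id 2 μ) [IsProbabilityMeasure μ]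
    (m : EuclideanSpace ℝ (Fin d)) (s : ℝ) (i j : Fin d) :
    cov[fun y => y i, fun y => y j; μ.map fun z => m + s • z] =
      s ^ 2 * cov[fun z => z i, fun z => z j; μ] := by
  have hi : ∀ i, Integrable (fun z : EuclideanSpace ℝ (Fin d) => s * z i) μ := fun i =>
    ((memLp_eval h i).integrable (by norm_num)).const_mul s
  rw [covariance_map_fun (Measurable.aestronglyMeasurable (by fun_prop))
    (Measurable.aestronglyMeasurable (by fun_prop)) (by fun_prop)]
  simp only [PiLp.add_apply, PiLp.smul_apply, smul_eq_mul]
  rw [covariance_const_add_left (hi i), covariance_const_add_right (hi j),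
    covariance_const_mul_left, covariance_const_mul_right]
  ring

variable {L D : ℝ} {a : EuclideanSpace ℝ (Fin d) → ℝ} {σ : ℝ → ℝ} {t : ℝ}

theorem posterior_wellDefined (ha : Measurable a) (hL : ∀ x, |a x| ≤ L) (hσ : 0 < σ t)
    (x : EuclideanSpace ℝ (Fin d)) :
    IsProbabilityMeasure (posterior (targetDensity a) σ 1 x t) ∧
      MemLp id 2 (posterior (targetDensity a) σ 1 x t) := by
  have hv : 0 < σ t ^ 2 / (σ t ^ 2 + t ^ 2) := by positivity
  rw [posterior_eq_map_tilted_stdGaussian ha hL hσ x (Real.sqrt_pos.2 hv) (Real.sq_sqrt hv.le)]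
  set s := √(σ t ^ 2 / (σ t ^ 2 + t ^ 2))
  set m := (t / (σ t ^ 2 + t ^ 2)) • x
  have hg : Measurable fun z : EuclideanSpace ℝ (Fin d) => -a (m + s • z) := by fun_prop
  have hgL : ∀ z, |-a (m + s • z)| ≤ L := fun z => by rw [abs_neg]; exact hL _
  have := isProbabilityMeasure_tilted (integrable_exp_of_bounded
    (μ := stdGaussian (EuclideanSpace ℝ (Fin d))) hg hgL)
  exact ⟨Measure.isProbabilityMeasure_map (by fun_prop),
    memLp_map_affine (memLp_two_of_tilted_stdGaussian hg hgL) m s⟩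

theorem abs_covariance_posterior_le (ha : Measurable a) (hL : ∀ x, |a x| ≤ L) (hσ : 0 < σ t)
    (x : EuclideanSpace ℝ (Fin d)) (i j : Fin d) :
    |cov[fun y => y i, fun y => y j; posterior (targetDensity a) σ 1 x t]| ≤ Real.exp (2 * L) := by
  have hv : 0 < σ t ^ 2 / (σ t ^ 2 + t ^ 2) := by positivity
  have hv1 : σ t ^ 2 / (σ t ^ 2 + t ^ 2) ≤ 1 := div_le_one_of_le₀ (by nlinarith) (by positivity)
  rw [posterior_eq_map_tilted_stdGaussian ha hL hσ x (Real.sqrt_pos.2 hv) (Real.sq_sqrt hv.le)]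
  rw [← Real.sq_sqrt hv.le] at hv1
  set s := √(σ t ^ 2 / (σ t ^ 2 + t ^ 2))
  set m := (t / (σ t ^ 2 + t ^ 2)) • x
  have hg : Measurable fun z : EuclideanSpace ℝ (Fin d) => -a (m + s • z) := by fun_prop
  have hgL : ∀ z, |-a (m + s • z)| ≤ L := fun z => by rw [abs_neg]; exact hL _
  have := isProbabilityMeasure_tilted (integrable_exp_of_bounded
    (μ := stdGaussian (EuclideanSpace ℝ (Fin d))) hg hgL)
  have hm := memLp_two_of_tilted_stdGaussian hg hgL
  rw [covariance_map_affine hm, abs_mul, abs_of_nonneg (sq_nonneg s)]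
  refine (mul_le_of_le_one_left (abs_nonneg _) hv1).trans ?_
  exact abs_covariance_le (memLp_eval hm i) (memLp_eval hm j)
    (variance_tilted_stdGaussian_le hg hgL i) (variance_tilted_stdGaussian_le hg hgL j)

theorem abs_covariance_posterior_sub_le (ha : Measurable a) (hL : ∀ x, |a x| ≤ L) (hD0 : 0 ≤ D)
    (hD : ∀ x y, |a x - a y| ≤ D * ‖x - y‖) (hσ : 0 < σ t) (ht : 0 < t)
    (x : EuclideanSpace ℝ (Fin d)) (i j : Fin d) :
    |cov[fun y => y i, fun y => y j; posterior (targetDensity a) σ 1 x t] -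
      if i = j then (σ t / t) ^ 2 else 0| ≤ (D * tiltConstant d L D + 1) * (σ t / t) ^ 3 := by
  have hv : 0 < σ t ^ 2 / (σ t ^ 2 + t ^ 2) := by positivity
  have hs0 := Real.sqrt_pos.2 hv
  have hs2 := Real.sq_sqrt hv.le
  rw [posterior_eq_map_tilted_stdGaussian ha hL hσ x hs0 hs2]
  set s := √(σ t ^ 2 / (σ t ^ 2 + t ^ 2))
  set m := (t / (σ t ^ 2 + t ^ 2)) • x
  have hg : Measurable fun z : EuclideanSpace ℝ (Fin d) => -a (m + s • z) := by fun_prop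
  have hgL : ∀ z, |-a (m + s • z)| ≤ L := fun z => by rw [abs_neg]; exact hL _
  have := isProbabilityMeasure_tilted (integrable_exp_of_bounded
    (μ := stdGaussian (EuclideanSpace ℝ (Fin d))) hg hgL)
  rw [covariance_map_affine (memLp_two_of_tilted_stdGaussian hg hgL)]
  set r := σ t / t
  have hr : 0 < r := div_pos hσ ht
  have hsr : s ^ 2 = r ^ 2 / (r ^ 2 + 1) := by
    rw [hs2]
    simp only [r]
    field_simp
  have hs1 : s ≤ 1 := by
    rw [← sq_le_one_iff₀ hs0.le, hsr]
    exact div_le_one_of_le₀ (by linarith) (by positivity)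
  have hsr' : s ≤ r := by
    rw [← pow_le_pow_iff_left₀ hs0.le hr.le two_ne_zero, hsr]
    exact div_le_self (by positivity) (by nlinarith)
  -- The shift `m` cancels, which makes the bound uniform in `x`; the scaling supplies the extra
  -- factor `s`.
  have hosc : ∀ z w, |-a (m + s • z) - -a (m + s • w)| ≤ D * s * (‖z‖ + ‖w‖) := fun z w => by
    rw [neg_sub_neg]
    refine (hD _ _).trans ?_
    rw [add_sub_add_left_eq_sub, ← smul_sub, norm_smul, Real.norm_of_nonneg hs0.le, ← mul_assoc,
      add_comm]
    gcongr
    exact norm_sub_le _ _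
  have hcov := abs_covariance_tilted_stdGaussian_sub_le hg hgL (by positivity : 0 ≤ D * s)
    (mul_le_of_le_one_right hD0 hs1) hosc i j
  set cv := cov[fun z => z i, fun z => z j;
    (stdGaussian (EuclideanSpace ℝ (Fin d))).tilted fun z => -a (m + s • z)]
  have hA := tiltConstant_nonneg d L hD0
  have h1 : s ^ 2 * |cv - if i = j then 1 else 0| ≤ D * tiltConstant d L D * r ^ 3 := by
    calc _ ≤ s ^ 2 * (D * s * tiltConstant d L D) := by gcongr
      _ = D * tiltConstant d L D * s ^ 3 := by ring
      _ ≤ _ := by gcongr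
  have h2 : |s ^ 2 - r ^ 2| ≤ r ^ 3 := by
    -- The difference is exactly `-r⁴ / (r² + 1)`, and `r ≤ r² + 1`. This accounts for the `+ 1` in
    -- the constant.
    have : s ^ 2 - r ^ 2 = -(r ^ 3 * (r / (r ^ 2 + 1))) := by
      rw [hsr]
      field_simp
      ring
    rw [this, abs_neg, abs_of_nonneg (by positivity)]
    exact mul_le_of_le_one_right (by positivity)
      (div_le_one_of_le₀ (by nlinarith [sq_nonneg (r - 1)]) (by positivity))
  rw [← abs_of_nonneg (sq_nonneg s), ← abs_mul] at h1
  split_ifs at h1 ⊢ with hij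
  · calc |s ^ 2 * cv - r ^ 2| = |s ^ 2 * (cv - 1) + (s ^ 2 - r ^ 2)| := by ring_nf
      _ ≤ _ := (abs_add_le _ _).trans ((add_le_add h1 h2).trans_eq (by ring))
  · rw [sub_zero] at h1 ⊢
    exact h1.trans (by nlinarith [pow_pos hr 3])

end PosteriorCovariance

theorem mainTheorem3 (d : ℕ) (L : ℝ≥0) :
    ∃ c ∈ Ioo (0 : ℝ) 1, ∃ K : ℝ, 0 ≤ K ∧
      ∀ a : EuclideanSpace ℝ (Fin d) → ℝ, ContDiff ℝ 2 a → ckNorm 2 a = (L : ℝ≥0∞) →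
      ∀ (σ : ℝ → ℝ) (σmin : ℝ), IsVarianceFunction σ σmin → σmin < c →
        (c ≤ σ (1 / 2) → ∃ tstar ∈ Ico (1 / 2 : ℝ) 1, σ tstar = c) ∧
        ∀ tstar ∈ Ico (1 / 2 : ℝ) 1, σ tstar ≤ c →
          CovarianceAssumption (targetDensity a) σ 1 1 tstar (Real.exp (2 * (L : ℝ))) K := by
  have hD0 : (0 : ℝ) ≤ d * L := by positivity
  have hA := tiltConstant_nonneg d L hD0
  -- The covariance estimates hold for every `t > 0`, so they put no constraint on `c` and `1 / 2`
  -- is an arbitrary choice. `K` comes from the Lipschitz constant `D = dL`.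
  refine ⟨1 / 2, by norm_num, d * L * tiltConstant d L (d * L) + 1, by positivity, ?_⟩
  intro a ha hnorm σ σmin hσ hmin
  have hmeas : Measurable a := ha.continuous.measurable
  have hbd := abs_le_of_ckNorm hnorm
  have hlip := abs_sub_le_of_ckNorm one_le_two (ha.differentiable (by norm_num)) hnorm
  refine ⟨fun hc => ?_, fun tstar htstar _ => ?_⟩
  · have hcont : ContinuousOn σ (Icc (1 / 2) 1) :=
      hσ.smooth.continuousOn.mono (Icc_subset_Icc_left (by norm_num))
    obtain ⟨t, ht, htc⟩ := intermediate_value_Icc' (by norm_num) hcont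
      (⟨by rw [hσ.one]; exact hmin.le, hc⟩ : (1 / 2 : ℝ) ∈ Icc (σ 1) (σ (1 / 2)))
    -- The endpoint `t = 1` is excluded because `σ 1 = σmin < c`.
    refine ⟨t, ⟨ht.1, lt_of_le_of_ne ht.2 ?_⟩, htc⟩
    rintro rfl
    rw [hσ.one] at htc
    exact hmin.ne htc
  have hpos : ∀ t ∈ Ioc tstar 1, 0 < t ∧ 0 < σ t := fun t ht => by
    have h0 : 0 < t := by linarith [htstar.1, ht.1]
    exact ⟨h0, hσ.pos t ⟨h0.le, ht.2⟩⟩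
  refine ⟨by simpa using htstar, fun x t ht => (posterior_wellDefined hmeas hbd (hσ.pos t ht) x).1,
    fun x t ht => (posterior_wellDefined hmeas hbd (hσ.pos t ht) x).2, fun x t ht i j hij => ?_,
    fun x t ht i => ?_, fun x t ht i j => ?_⟩
  · have := abs_covariance_posterior_sub_le hmeas hbd hD0 hlip (hpos t ht).2 (hpos t ht).1 x i j
    simpa [hij] using this
  · have := abs_covariance_posterior_sub_le hmeas hbd hD0 hlip (hpos t ht).2 (hpos t ht).1 x i i
    rw [if_pos rfl, covariance_self (Measurable.aemeasurable (by fun_prop))] at this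
    rw [Real.rpow_one, div_one, Real.rpow_one]
    exact this.trans_eq (by ring)
  · exact abs_covariance_posterior_le hmeas hbd
      (hσ.pos t ⟨ht.1, ht.2.trans htstar.2.le⟩) x i j
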